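/- Let $N\ge 1$ be an integer, let $h=1/N$ and $\hbar=h/(2\pi)=1/(2\pi N)$, and let $\theta=(\theta_1,\theta_2)\in\mathbb{R}^2$ (representing a point of the torus $\mathbb{T}^2$). For $m=0,\dots,N-1$ let $\Phi_m^{(\theta)}$ be the $\delta$-comb (a locally finite complex measure on $\mathbb{R}$) $$\Phi_m^{(\theta)}(x)=\frac{e^{2\pi i\theta_2 m/N}}{\sqrt N}\sum_{k\in\mathbb{Z}}e^{2\pi i\theta_2 k}\,\delta\!\left(x-\Big(\frac{m+\theta_1}{N}+k\Big)\right).$$ Let $$g(r)=\frac{1}{2\pi\hbar}\,e^{-\hbar r^2+ir}\,\frac{\sin r}{r}\quad\Big(\tfrac{\sin r}{r}:=1\text{ at } r=0\Big),\qquad K(x,y)=g\!\left(\frac{x-y}{2\hbar}\right),$$ and, for locally finite complex measures $\Psi_1,\Psi_2$ on $\mathbb{R}$ (written as generalized functions) for which the integrals converge absolutely, put $$(K\Psi_2)(x)=\int_{\mathbb{R}}K(x,y)\Psi_2(y)\,dy,\qquad(\Psi_1,\Psi_2)_P=\int_{[0,1)}\overline{\Psi_1(x)}\,(K\Psi_2)(x)\,dx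 .$$ Then, for all $m,n\in\{0,\dots,N-1\}$, the integrals defining $(\Phi_m^{(\theta)},\Phi_n^{(\theta)})_P$ converge absolutely and $$\big(\Phi_m^{(\theta)},\Phi_n^{(\theta)}\big)_P=\delta_{mn}.$$ -/

import Mathlib

open MeasureTheory

/-- A generalized wave function of order zero on the real line: the complex Radon measure
`Ψ = density · base`. An ordinary wave function `f` is the case `base = volume`, `density = f`; a
`δ`-comb has as `base` a sum of unit point masses. The "value" `Ψ(x) dx` is
`density x ∂base`, and `conj Ψ` is `conj density · base`. -/
structure GenWave where
  base : Measure ℝ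
  density : ℝ → ℂ
  locallyIntegrable : LocallyIntegrable density base

namespace GenWave

/-- The pairing `∫ F(x) Ψ(x) dx` of a generalized wave function with a function. -/
noncomputable def pair (Ψ : GenWave) (F : ℝ → ℂ) : ℂ :=
  ∫ x, F x * Ψ.density x ∂Ψ.base

end GenWave

/-- The reduced Planck constant `ħ = h / (2π)` for `h = 1 / N`. -/
noncomputable def reducedPlanck (N : ℕ) : ℝ := (1 / (N : ℝ)) / (2 * Real.pi)

/-- `g(r) = (2πħ)⁻¹ exp(-ħ r² + i r) (sin r / r)`, with `sin r / r = 1` at `r = 0`. -/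
noncomputable def diffractionProfile (ħ r : ℝ) : ℂ :=
  1 / (2 * Real.pi * ħ) * Complex.exp (-ħ * r ^ 2 + Complex.I * r) * (Real.sinc r : ℂ)

/-- The kernel `K(x, y) = g((x - y) / (2ħ))`. -/
noncomputable def diffractionKernel (ħ x y : ℝ) : ℂ :=
  diffractionProfile ħ ((x - y) / (2 * ħ))

/-- `(KΨ)(x) = ∫_ℝ K(x, y) Ψ(y) dy`. -/
noncomputable def kernelApply (ħ : ℝ) (Ψ : GenWave) (x : ℝ) : ℂ :=
  Ψ.pair (diffractionKernel ħ x)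

/-- `(Ψ₁, Ψ₂)_P = ∫₀¹ conj (Ψ₁(x)) (KΨ₂)(x) dx`. The fundamental domain of `ℝ / ℤ` is taken
half-open, so that an atom on its boundary is counted once. -/
noncomputable def fiberInner (ħ : ℝ) (Ψ₁ Ψ₂ : GenWave) : ℂ :=
  ∫ x in Set.Ico (0 : ℝ) 1, (starRingEnd ℂ) (Ψ₁.density x) * kernelApply ħ Ψ₂ x ∂Ψ₁.base

/-- All integrals in `(Ψ₁, Ψ₂)_P` converge absolutely. -/
def FiberInnerConverges (ħ : ℝ) (Ψ₁ Ψ₂ : GenWave) : Prop :=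
  (∀ x : ℝ, Integrable (fun y => diffractionKernel ħ x y * Ψ₂.density y) Ψ₂.base) ∧
    IntegrableOn (fun x => (starRingEnd ℂ) (Ψ₁.density x) * kernelApply ħ Ψ₂ x)
      (Set.Ico (0 : ℝ) 1) Ψ₁.base

/-- The Dirac comb `∑_{k ∈ ℤ} δ(x - (a + k))`. -/
noncomputable def diracComb (a : ℝ) : Measure ℝ :=
  Measure.sum fun k : ℤ => Measure.dirac (a + k)

instance diracComb_isLocallyFiniteMeasure (a : ℝ) : IsLocallyFiniteMeasure (diracComb a) := by
  refine ⟨fun x => ⟨Metric.ball x 1, Metric.ball_mem_nhds x one_pos, ?_⟩⟩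
  rw [diracComb, Measure.sum_apply _ measurableSet_ball]
  have hfin : Set.Finite {k : ℤ | a + (k : ℝ) ∈ Metric.ball x 1} := by
    refine (Set.finite_Icc ⌊x - 1 - a⌋ ⌈x + 1 - a⌉).subset fun k hk => ?_
    simp only [Set.mem_ofPred_eq, Metric.mem_ball, Real.dist_eq, abs_lt] at hk
    constructor
    · have := Int.floor_le (x - 1 - a)
      have h : ((⌊x - 1 - a⌋ : ℤ) : ℝ) ≤ k := by linarith [hk.1]
      exact_mod_cast h
    · have := Int.le_ceil (x + 1 - a)
      have h : (k : ℝ) ≤ (⌈x + 1 - a⌉ : ℤ) := by linarith [hk.2]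
      exact_mod_cast h
  rw [tsum_eq_sum (s := hfin.toFinset)]
  · exact ENNReal.sum_lt_top.2 fun k _ => measure_lt_top _ _
  · intro k hk
    have hk' : a + (k : ℝ) ∉ Metric.ball x 1 := by simpa using hk
    rw [Measure.dirac_apply' _ measurableSet_ball, Set.indicator_of_notMem hk']

/-- The position state
`Φ_m^{(θ)}(x) = N^{-1/2} e^{2πi θ₂ m / N} ∑_{k ∈ ℤ} e^{2πi θ₂ k} δ(x - ((m + θ₁)/N + k))`.
At the atom `x = (m + θ₁)/N + k` the last factor of the density is `e^{2πi θ₂ k}`;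
see `positionState_pair`. -/
noncomputable def positionState (N : ℕ) (θ₁ θ₂ : ℝ) (m : Fin N) : GenWave where
  base := diracComb (((m : ℕ) + θ₁) / N)
  density x := Complex.exp (2 * Real.pi * Complex.I * θ₂ * (m : ℕ) / N) / (Real.sqrt N : ℂ) *
    Complex.exp (2 * Real.pi * Complex.I * θ₂ * ((x - ((m : ℕ) + θ₁) / N : ℝ) : ℂ))
  locallyIntegrable := Continuous.locallyIntegrable (by fun_prop)

/-- As a functional on (say continuous, rapidly decreasing) functions, the position state is the
`δ`-comb. -/
theorem positionState_pair (N : ℕ) (θ₁ θ₂ : ℝ) (m : Fin N) (F : ℝ → ℂ)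
    (hF : Integrable (fun x => F x * (positionState N θ₁ θ₂ m).density x)
      (positionState N θ₁ θ₂ m).base) :
    (positionState N θ₁ θ₂ m).pair F =
      Complex.exp (2 * Real.pi * Complex.I * θ₂ * (m : ℕ) / N) / (Real.sqrt N : ℂ) *
        ∑' k : ℤ, Complex.exp (2 * Real.pi * Complex.I * θ₂ * k) *
          F (((m : ℕ) + θ₁) / N + k) := by
  have h := hasSum_integral_measure (μ := fun k : ℤ =>
    Measure.dirac ((((m : ℕ) : ℝ) + θ₁) / N + k)) hF
  rw [← tsum_mul_left]
  refine h.tsum_eq.symm.trans (tsum_congr fun k => ?_)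
  rw [integral_dirac]
  simp only [positionState, add_sub_cancel_left, Complex.ofReal_intCast]
  ring

/-!
Every integral against a position state is a sum over its atoms, so the pairing is governed by the
values of the kernel at pairs of atoms. With `ħ = 1 / (2πN)` one has `(x - y) / (2ħ) = πN(x - y)`.
If `x` is an atom of the `m`-th comb and `y` an atom of the `n`-th comb, then `N(x - y)` is an
integer congruent to `m - n` modulo `N`. Since `sinc` vanishes at all nonzero integer multiples of
`π`, the kernel `K(x, y)` vanishes unless `x = y` (`diffractionKernel_eq_zero`), and this forces
`m = n`. On the diagonal `K(x, x) = 1 / (2πħ) = N`, while the density has modulus `1 / √N`.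
As `[0, 1)` contains exactly one atom of the comb (`diracComb_restrict_Ico`), the pairing is
`N · (1 / √N)² = 1` for `m = n` and `0` otherwise.

At a general point `x` the integral defining `KΨ` converges absolutely because of the Gaussian
factor of the kernel: the sum of `exp (-c (k + b)²)` over the integers `k` is finite.
-/

theorem diracComb_restrict_Ico (a : ℝ) :
    (diracComb a).restrict (Set.Ico 0 1) = Measure.dirac (Int.fract a) := by
  ext s hs
  rw [Measure.restrict_apply hs, diracComb, Measure.sum_apply _ (hs.inter measurableSet_Ico),
    tsum_eq_single (-⌊a⌋)]
  · have h : a + ((-⌊a⌋ : ℤ) : ℝ) = Int.fract a := by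
      rw [Int.cast_neg, ← sub_eq_add_neg, Int.self_sub_floor]
    rw [h, Measure.dirac_apply' _ (hs.inter measurableSet_Ico), Measure.dirac_apply' _ hs]
    have hmem : Int.fract a ∈ Set.Ico (0 : ℝ) 1 := ⟨Int.fract_nonneg a, Int.fract_lt_one a⟩
    by_cases hs' : Int.fract a ∈ s
    · rw [Set.indicator_of_mem hs', Set.indicator_of_mem (Set.mem_inter hs' hmem)]
    · rw [Set.indicator_of_notMem hs', Set.indicator_of_notMem fun hmem' => hs' hmem'.1]
  · intro k hk
    rw [Measure.dirac_apply' _ (hs.inter measurableSet_Ico), Set.indicator_of_notMem]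
    rintro ⟨-, h0, h1⟩
    refine hk ?_
    have : ⌊a + (k : ℝ)⌋ = 0 := Int.floor_eq_zero_iff.2 ⟨h0, h1⟩
    rw [Int.floor_add_intCast] at this
    omega

theorem integrable_diracComb {a : ℝ} {F : ℝ → ℂ} (hF : Summable fun k : ℤ => ‖F (a + k)‖) :
    Integrable F (diracComb a) :=
  integrable_sum_measure (fun k => integrable_dirac (by simp)) (by simpa using hF)

theorem integral_diracComb_eq_single {a : ℝ} {F : ℝ → ℂ} (hF : Integrable F (diracComb a)) (j : ℤ)
    (hj : ∀ k : ℤ, k ≠ j → F (a + k) = 0) : ∫ x, F x ∂diracComb a = F (a + j) := by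
  have h := hasSum_integral_measure (μ := fun k : ℤ => Measure.dirac (a + (k : ℝ))) hF
  simp only [integral_dirac] at h
  exact h.unique (hasSum_single j hj)

theorem reducedPlanck_pos {N : ℕ} (hN : 0 < N) : 0 < reducedPlanck N := by
  unfold reducedPlanck
  positivity

theorem two_pi_mul_reducedPlanck (N : ℕ) : 2 * Real.pi * reducedPlanck N = 1 / N := by
  unfold reducedPlanck
  field_simp

theorem norm_diffractionKernel_le {ħ : ℝ} (hħ : 0 < ħ) (x y : ℝ) :
    ‖diffractionKernel ħ x y‖ ≤
      1 / (2 * Real.pi * ħ) * Real.exp (-(x - y) ^ 2 / (4 * ħ)) := by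
  unfold diffractionKernel diffractionProfile
  have h1 : ‖(1 / (2 * Real.pi * ħ) : ℂ)‖ = 1 / (2 * Real.pi * ħ) := by
    have : (1 / (2 * Real.pi * ħ) : ℂ) = ((1 / (2 * Real.pi * ħ) : ℝ) : ℂ) := by push_cast; rfl
    rw [this, Complex.norm_real, Real.norm_of_nonneg (by positivity)]
  have h2 : ∀ r : ℝ, (-(ħ : ℂ) * (r : ℂ) ^ 2 + Complex.I * r).re = -ħ * r ^ 2 := fun r => by
    have h : (-(ħ : ℂ) * (r : ℂ) ^ 2 + Complex.I * r) =
        ((-ħ * r ^ 2 : ℝ) : ℂ) + r * Complex.I := by push_cast; ring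
    rw [h, Complex.add_re, Complex.ofReal_re, Complex.re_ofReal_mul, Complex.I_re, mul_zero,
      add_zero]
  rw [norm_mul, norm_mul, h1, Complex.norm_exp, h2, Complex.norm_real, Real.norm_eq_abs]
  have h3 : -ħ * ((x - y) / (2 * ħ)) ^ 2 = -(x - y) ^ 2 / (4 * ħ) := by
    field_simp
    ring
  rw [h3]
  exact mul_le_of_le_one_right (by positivity) (Real.abs_sinc_le_one _)

theorem summable_norm_diffractionKernel {ħ : ℝ} (hħ : 0 < ħ) (x a : ℝ) :
    Summable fun k : ℤ => ‖diffractionKernel ħ x (a + k)‖ := by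
  have ht : 0 < 1 / (4 * Real.pi * ħ) := by positivity
  have hs := (HurwitzZeta.hasSum_int_evenKernel (a - x) ht).summable.mul_left
    (1 / (2 * Real.pi * ħ))
  refine Summable.of_nonneg_of_le (fun _ => norm_nonneg _) (fun k => ?_) hs
  refine (norm_diffractionKernel_le hħ x (a + k)).trans_eq ?_
  congr 2
  field_simp
  ring

theorem diffractionKernel_self {N : ℕ} (x : ℝ) :
    diffractionKernel (reducedPlanck N) x x = N := by
  have h : (2 * Real.pi * reducedPlanck N : ℂ) = 1 / N := by
    simpa using congrArg Complex.ofReal (two_pi_mul_reducedPlanck N)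
  simp [diffractionKernel, diffractionProfile, h]

/-- At points whose difference is `j / N`, the argument of `sinc` in the kernel is `jπ`. -/
theorem diffractionKernel_eq_zero {N : ℕ} (hN : 0 < N) {x y : ℝ} {j : ℤ} (hj : j ≠ 0)
    (hxy : x - y = j / N) : diffractionKernel (reducedPlanck N) x y = 0 := by
  have hr : (x - y) / (2 * reducedPlanck N) = j * Real.pi := by
    rw [hxy, reducedPlanck]
    field_simp
  have hr0 : (j * Real.pi : ℝ) ≠ 0 := mul_ne_zero (Int.cast_ne_zero.2 hj) Real.pi_ne_zero
  rw [diffractionKernel, diffractionProfile, hr, Real.sinc_of_ne_zero hr0, Real.sin_int_mul_pi]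
  simp

theorem norm_positionState_density (N : ℕ) (θ₁ θ₂ : ℝ) (m : Fin N) (x : ℝ) :
    ‖(positionState N θ₁ θ₂ m).density x‖ = 1 / Real.sqrt N := by
  have h1 : (2 * Real.pi * Complex.I * θ₂ * (m : ℕ) / N : ℂ) =
      ((2 * Real.pi * θ₂ * (m : ℕ) / N : ℝ) : ℂ) * Complex.I := by push_cast; ring
  have h2 : ∀ t : ℝ, (2 * Real.pi * Complex.I * θ₂ * t : ℂ) =
      ((2 * Real.pi * θ₂ * t : ℝ) : ℂ) * Complex.I := fun t => by push_cast; ring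
  simp only [positionState]
  rw [h1, h2, norm_mul, norm_div, Complex.norm_exp_ofReal_mul_I, Complex.norm_exp_ofReal_mul_I,
    Complex.norm_real, Real.norm_of_nonneg (Real.sqrt_nonneg _), mul_one]

theorem integrable_diffractionKernel_positionState {ħ : ℝ} (hħ : 0 < ħ) (N : ℕ) (θ₁ θ₂ : ℝ)
    (n : Fin N) (x : ℝ) :
    Integrable (fun y => diffractionKernel ħ x y * (positionState N θ₁ θ₂ n).density y)
      (positionState N θ₁ θ₂ n).base := by
  refine integrable_diracComb ?_
  simp only [norm_mul, norm_positionState_density]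
  exact (summable_norm_diffractionKernel hħ x _).mul_right _

/-- The kernel acts on a position state, at its own atoms, as multiplication by `N`: the values
`K(x, y)` at two distinct atoms vanish. -/
theorem kernelApply_positionState_self {N : ℕ} (hN : 0 < N) (θ₁ θ₂ : ℝ) (m : Fin N) (j : ℤ) :
    kernelApply (reducedPlanck N) (positionState N θ₁ θ₂ m) (((m : ℕ) + θ₁) / N + j) =
      N * (positionState N θ₁ θ₂ m).density (((m : ℕ) + θ₁) / N + j) := by
  refine (integral_diracComb_eq_single (integrable_diffractionKernel_positionState
    (reducedPlanck_pos hN) N θ₁ θ₂ m _) j fun k hk => ?_).trans ?_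
  · rw [diffractionKernel_eq_zero hN (j := N * (j - k)), zero_mul]
    · exact mul_ne_zero (by exact_mod_cast hN.ne') (sub_ne_zero.2 hk.symm)
    · push_cast
      field_simp
      ring
  · rw [diffractionKernel_self]

/-- The image of a position state under the kernel vanishes at the atoms of the other position
states. -/
theorem kernelApply_positionState_of_ne {N : ℕ} (hN : 0 < N) (θ₁ θ₂ : ℝ) {m n : Fin N}
    (hmn : m ≠ n) (j : ℤ) :
    kernelApply (reducedPlanck N) (positionState N θ₁ θ₂ n) (((m : ℕ) + θ₁) / N + j) = 0 := by
  have h : ∀ k : ℤ, diffractionKernel (reducedPlanck N) (((m : ℕ) + θ₁) / N + j)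
      (((n : ℕ) + θ₁) / N + k) = 0 := fun k => by
    refine diffractionKernel_eq_zero hN (j := (m : ℕ) - (n : ℕ) + N * (j - k)) (fun h0 => ?_) ?_
    · -- Otherwise `m` and `n` are congruent modulo `N`, hence equal.
      refine hmn (Fin.ext (Nat.ModEq.eq_of_lt_of_lt ?_ m.2 n.2))
      refine (Int.natCast_modEq_iff.1 (Int.modEq_iff_dvd.2 ⟨j - k, ?_⟩))
      linarith
    · push_cast
      field_simp
      ring
  refine (integral_diracComb_eq_single (integrable_diffractionKernel_positionState
    (reducedPlanck_pos hN) N θ₁ θ₂ n _) 0 fun k _ => ?_).trans ?_ <;>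
  rw [h, zero_mul]

theorem mainTheorem7 (N : ℕ) (hN : 0 < N) (θ₁ θ₂ : ℝ) (m n : Fin N) :
    FiberInnerConverges (reducedPlanck N) (positionState N θ₁ θ₂ m) (positionState N θ₁ θ₂ n) ∧
      fiberInner (reducedPlanck N) (positionState N θ₁ θ₂ m) (positionState N θ₁ θ₂ n) =
        if m = n then 1 else 0 := by
  have hbase : (positionState N θ₁ θ₂ m).base.restrict (Set.Ico 0 1) =
      Measure.dirac (Int.fract (((m : ℕ) + θ₁) / N)) := diracComb_restrict_Ico _
  refine ⟨⟨integrable_diffractionKernel_positionState (reducedPlanck_pos hN) N θ₁ θ₂ n, ?_⟩, ?_⟩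
  · rw [IntegrableOn, hbase]
    exact integrable_dirac enorm_lt_top
  · have hfract : Int.fract (((m : ℕ) + θ₁) / N) =
        ((m : ℕ) + θ₁) / N + ((-⌊((m : ℕ) + θ₁) / N⌋ : ℤ) : ℝ) := by
      rw [Int.cast_neg, ← sub_eq_add_neg, Int.self_sub_floor]
    rw [fiberInner, hbase, integral_dirac, hfract]
    split_ifs with hmn
    · subst hmn
      rw [kernelApply_positionState_self hN, mul_left_comm, Complex.conj_mul',
        norm_positionState_density]
      have hsq : (N : ℝ) * (1 / Real.sqrt N) ^ 2 = 1 := by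
        rw [div_pow, one_pow, Real.sq_sqrt (Nat.cast_nonneg N)]
        field_simp
      exact_mod_cast hsq
    · rw [kernelApply_positionState_of_ne hN θ₁ θ₂ hmn, mul_zero]
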